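/- **Theorem.** Weighted All-Or-One Paging has a deterministic $O(k)$-competitive online algorithm; the ratio $24k+3$ is attained, with no additive constant. In detail: let $k\ge 1$ be the number of cache slots. A cache configuration $C$ assigns to each slot $s\in[k]=\{1,\dots,k\}$ a single page or leaves it empty. Each page $p$ has a weight $w(p)\ge 0$. A request is a pair $(p,S)$ of a page $p$ and a slot set $S$ that is either $[k]$ (a general request) or $\{j\}$ for some $j\in[k]$ (a specific request); $C$ satisfies $(p,S)$ if it assigns $p$ to at least one slot in $S$. A solution for a request sequence $\sigma=(\sigma_1,\dots,\sigma_T)$ is a sequence of configurations $C_1,\dots,C_T$ such that $C_t$ satisfies $\sigma_t$ for every $t$; with $C_0$ the empty cache, its cost is $\sum_{t=1}^{T}\sum w(p)$, where the inner sum is over all pairs $(s,p)$ such that $C_t$ assigns $p$ to slot $s$ and $C_{t-1}$ does not. Let $\mathrm{opt}_w(\sigma)$ be the minimum cost of a solution. A deterministic online algorithm determines $C_t$ from the requests $\sigma_1,\dots,\sigma_t$ and the weights of the pages requested in them. For every $k\ge1$ and every set of pages there is a deterministic online algorithm that, for every non-negative weight function $w$ and every finite request sequence $\sigma$, produces a solution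 of cost at most $(24k+3)\,\mathrm{opt}_w(\sigma)$. -/

import Mathlib

open scoped NNReal

namespace WeightedAllOrOnePaging

/-- A cache configuration with `k` slots: each slot holds a single page or is empty. -/
abbrev Config (k : ℕ) (Page : Type*) := Fin k → Option Page

/-- The empty cache, which precedes the first request. -/
def emptyConfig (k : ℕ) (Page : Type*) : Config k Page := fun _ => none

/-- The slots allowed by a request: either all slots, or one prescribed slot. -/
inductive SlotSpec (k : ℕ) where
  | general : SlotSpec k
  | specific (j : Fin k) : SlotSpec k

/-- The requestable slot set, a member of `{[k]} ∪ {{j} : j ∈ [k]}`. -/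
def SlotSpec.slots {k : ℕ} : SlotSpec k → Finset (Fin k)
  | .general => Finset.univ
  | .specific j => {j}

/-- A request: a page together with the set of slots that may serve it. -/
structure Request (k : ℕ) (Page : Type*) where
  page : Page
  spec : SlotSpec k

/-- `C` satisfies the request if it assigns the page to at least one allowed slot. -/
def Satisfies {k : ℕ} {Page : Type*} (C : Config k Page) (r : Request k Page) : Prop :=
  ∃ s ∈ r.spec.slots, C s = some r.page

open Classical in
/-- The cost of changing the content of one slot from `old` to `new`: the weight of the new page,
if a page is retrieved that was not in this slot before. Evictions are free. -/
noncomputable def slotCost {Page : Type*} (w : Page → ℝ≥0) (old new : Option Page) : ℝ≥0 :=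
  match new with
  | none => 0
  | some p => if old = some p then 0 else w p

/-- The total weight of the retrievals made when going from `C` to `D`. -/
noncomputable def stepCost {k : ℕ} {Page : Type*} (w : Page → ℝ≥0) (C D : Config k Page) : ℝ≥0 :=
  ∑ s : Fin k, slotCost w (C s) (D s)

/-- The cost of the first `T` steps of a sequence of configurations;
`C t` is the configuration after `t` requests have been served. -/
noncomputable def cost {k : ℕ} {Page : Type*} (w : Page → ℝ≥0) (T : ℕ) (C : ℕ → Config k Page) :
    ℝ≥0 :=
  ∑ t ∈ Finset.range T, stepCost w (C t) (C (t + 1))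

/-- `C` is a solution for `σ`: it starts with the empty cache, and the configuration that follows
the arrival of each request satisfies this request. Values of `C` beyond the length of `σ`
play no role. -/
def IsSolution {k : ℕ} {Page : Type*} (σ : List (Request k Page)) (C : ℕ → Config k Page) : Prop :=
  C 0 = emptyConfig k Page ∧ ∀ (t : ℕ) (ht : t < σ.length), Satisfies (C (t + 1)) σ[t]

/-- The offline optimum: the least cost of a solution. -/
noncomputable def opt {k : ℕ} {Page : Type*} (w : Page → ℝ≥0) (σ : List (Request k Page)) : ℝ≥0 :=
  sInf {c | ∃ C : ℕ → Config k Page, IsSolution σ C ∧ cost w σ.length C = c}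

/-- With at least one slot every request sequence has a solution, so that `opt` is an infimum
over a nonempty set. -/
theorem exists_isSolution {k : ℕ} (hk : 1 ≤ k) {Page : Type*} (σ : List (Request k Page)) :
    ∃ C : ℕ → Config k Page, IsSolution σ C := by
  refine ⟨fun t => match t with
    | 0 => emptyConfig k Page
    | t + 1 => fun _ => (σ[t]?).map Request.page, rfl, fun t ht => ?_⟩
  cases h : σ[t].spec with
  | general => exact ⟨⟨0, hk⟩, by simp [h, SlotSpec.slots], by simp [ht]⟩
  | specific j => exact ⟨j, by simp [h, SlotSpec.slots], by simp [ht]⟩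

/-- A deterministic online algorithm: it maps the requests revealed so far (including the current
one), each together with the weight of the requested page, to the next cache configuration.
Weights of pages that have not been requested yet are not available to it. -/
abbrev OnlineAlgorithm (k : ℕ) (Page : Type*) := List (Request k Page × ℝ≥0) → Config k Page

/-- The configurations produced by an online algorithm on `σ`, when pages have weights `w`. -/
def OnlineAlgorithm.run {k : ℕ} {Page : Type*} (A : OnlineAlgorithm k Page) (w : Page → ℝ≥0)
    (σ : List (Request k Page)) : ℕ → Config k Page
  | 0 => emptyConfig k Page
  | t + 1 => A ((σ.take (t + 1)).map fun r => (r, w r.page))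

/-- `A` is `c`-competitive with additive constant `b`: for all page weights and all request
sequences, `A` produces a solution, of cost at most `c` times the optimum plus `b`. -/
def OnlineAlgorithm.IsCompetitive {k : ℕ} {Page : Type*} (A : OnlineAlgorithm k Page)
    (c b : ℝ≥0) : Prop :=
  ∀ (w : Page → ℝ≥0) (σ : List (Request k Page)),
    IsSolution σ (A.run w σ) ∧ cost w σ.length (A.run w σ) ≤ c * opt w σ + b

end WeightedAllOrOnePaging

namespace WeightedAllOrOnePaging

open Finset

/-! The algorithm is governed by an amortised potential. Every page has a credit, raised to its
weight when a general request loads it. Every slot has a lease, raised to the weight of a page that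
a specific request loads there. Every slot also has a height, and a page with positive credit must
lie in a slot at least as high as its weight rounded down to a power of two. For an adversary cache
`C` the potential is `(5k-1)(credits + leases) + 4 (heights) - (5k+4) (discounts of C)`.

Whenever the credits and leases to be honoured do not fit into the cache, rent is collected: a
family of them falls by a common `δ`, and the slots too low for its pages rise by `δ`. The adversary
has fewer slots to honour the family than the family has members, so the potential does not rise
(`State.potential_rent_le`). Each maximal rent exhausts a credit or a lease or closes a gap between
a height and a level, so collecting stops. It stops with a Hall-type counting condition, under which
`exists_insert` places one more page by a chain of replacements of geometrically decreasing weight,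
at cost at most four times its rounded weight.

A general load of `q` lowers the potential by `5 w(q)`: one part pays for the load, four for the
chain. A specific load of `p` into `j` lowers it by `w(p) + 4 height(j)`, which pays for the load
and for moving away the page that needed slot `j`. With the term `3(5k+4) w(C)` added, the potential
is nonnegative, and a move of the adversary raises it by at most `3(5k+4) = 15k+12` times its cost,
which is at most `24k+3` times since `k ≥ 1`. -/

/-! ### Rounding weights down to powers of two. -/

/-- The largest power of two that is at most `x`, and `0` for `x = 0`. -/
noncomputable def lowerPow (x : ℝ≥0) : ℝ := if x = 0 then 0 else (2 : ℝ) ^ Int.log 2 (x : ℝ)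

lemma lowerPow_zero : lowerPow 0 = 0 := by simp [lowerPow]

lemma lowerPow_nonneg (x : ℝ≥0) : 0 ≤ lowerPow x := by
  unfold lowerPow
  split_ifs
  · exact le_rfl
  · positivity

lemma lowerPow_le (x : ℝ≥0) : lowerPow x ≤ x := by
  unfold lowerPow
  split_ifs with h
  · simp [h]
  · have hx : (0 : ℝ) < x := by exact_mod_cast pos_iff_ne_zero.2 h
    exact_mod_cast Int.zpow_log_le_self (b := 2) (by norm_num) hx

lemma le_two_mul_lowerPow (x : ℝ≥0) : (x : ℝ) ≤ 2 * lowerPow x := by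
  unfold lowerPow
  split_ifs with h
  · simp [h]
  · have := Int.lt_zpow_succ_log_self (b := 2) (by norm_num) (x : ℝ)
    rw [zpow_add₀ (by norm_num)] at this
    push_cast at this
    linarith

/-- The gap between distinct rounded weights makes the cost of a replacement chain a geometric sum.
-/
lemma two_mul_lowerPow_le {x y : ℝ≥0} (h : lowerPow x < lowerPow y) :
    2 * lowerPow x ≤ lowerPow y := by
  unfold lowerPow at *
  split_ifs at * with hx hy hy
  · simp
  · simp only [mul_zero]; positivity
  · exact absurd h (not_lt.2 (by positivity))
  · have h1 := (zpow_lt_zpow_iff_right₀ (by norm_num : (1 : ℝ) < 2)).1 h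
    calc 2 * (2 : ℝ) ^ Int.log 2 (x : ℝ) = (2 : ℝ) ^ (Int.log 2 (x : ℝ) + 1) := by
          rw [zpow_add₀ (by norm_num)]; ring
      _ ≤ _ := zpow_le_zpow_right₀ (by norm_num) h1

/-! ### Elementary estimates for retrieval costs. -/

section Cost

variable {k : ℕ} {Page : Type*}

lemma slotCost_self (w : Page → ℝ≥0) (a : Option Page) : slotCost w a a = 0 := by
  cases a <;> simp [slotCost]

lemma slotCost_some_le (w : Page → ℝ≥0) (a : Option Page) (p : Page) :
    slotCost w a (some p) ≤ w p := by
  unfold slotCost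
  dsimp only
  split_ifs <;> simp

lemma slotCost_triangle (w : Page → ℝ≥0) (a b c : Option Page) :
    slotCost w a c ≤ slotCost w a b + slotCost w b c := by
  cases c with
  | none => simp [slotCost]
  | some p =>
    by_cases h : b = some p
    · subst h; simp [slotCost_self]
    · have : slotCost w b (some p) = w p := by simp [slotCost, h]
      rw [this]
      exact (slotCost_some_le w a p).trans le_add_self

lemma stepCost_self (w : Page → ℝ≥0) (C : Config k Page) : stepCost w C C = 0 := by
  simp [stepCost, slotCost_self]

lemma stepCost_triangle (w : Page → ℝ≥0) (C D E : Config k Page) :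
    stepCost w C E ≤ stepCost w C D + stepCost w D E := by
  unfold stepCost
  rw [← sum_add_distrib]
  exact sum_le_sum fun s _ => slotCost_triangle w _ _ _

lemma stepCost_update_le (w : Page → ℝ≥0) (C : Config k Page) (s : Fin k) (p : Page) :
    stepCost w C (Function.update C s (some p)) ≤ w p := by
  unfold stepCost
  rw [sum_eq_single s]
  · simpa using slotCost_some_le w (C s) p
  · intro b _ hb
    rw [Function.update_of_ne hb, slotCost_self]
  · simp

lemma stepCost_congr {v w : Page → ℝ≥0} {C D : Config k Page}
    (h : ∀ s p, D s = some p → v p = w p) : stepCost v C D = stepCost w C D := by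
  unfold stepCost
  refine sum_congr rfl fun s _ => ?_
  cases hD : D s with
  | none => rfl
  | some p => simp [slotCost, h s p hD]

end Cost

/-! ### Inserting a page by a chain of replacements. -/

section Insertion

variable {k : ℕ} {Page : Type*}

/-- Every page of `X` is held by a slot outside `F` that is high enough for it. -/
def Hosts (w : Page → ℝ≥0) (h : Fin k → ℝ) (F : Finset (Fin k)) (C : Config k Page)
    (X : Finset Page) : Prop :=
  ∀ x ∈ X, ∃ s, s ∉ F ∧ C s = some x ∧ lowerPow (w x) ≤ h s

open Classical in
/-- If the slots outside `F` have room for one more page `q`, it can be inserted by a chain of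
replacements, in which each page replaces one that is at most half as heavy. -/
theorem exists_insert (w : Page → ℝ≥0) (h : Fin k → ℝ) (F : Finset (Fin k)) (n : ℕ) :
    ∀ (X : Finset Page) (q : Page) (C : Config k Page),
      #{x ∈ X | lowerPow (w x) < lowerPow (w q)} ≤ n → q ∉ X → Hosts w h F C X →
      (∀ ω ≤ lowerPow (w q), #{x ∈ X | ω ≤ lowerPow (w x)} + 1 ≤ #{s | s ∉ F ∧ ω ≤ h s}) →
      ∃ C' : Config k Page, Hosts w h F C' (insert q X) ∧ (∀ s ∈ F, C' s = C s) ∧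
        (∀ s p, C' s = some p → p = q ∨ ∃ s', C s' = some p) ∧
        (stepCost w C C' : ℝ) ≤ 4 * lowerPow (w q) := by
  induction n with
  | zero | succ n ih => ?_
  all_goals
    intro X q C hn hq hX hall
    have : Nonempty (Fin k) := by
      obtain ⟨s, -⟩ := card_pos.1 (Nat.lt_of_lt_of_le (Nat.succ_pos _) (hall _ le_rfl))
      exact ⟨s⟩
    choose! ρ hρF hρ hρh using hX
    have hinj : Set.InjOn ρ X := fun x hx y hy hxy => by
      have := hρ x hx
      rw [hxy, hρ y hy] at this
      exact (Option.some.inj this).symm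
    -- The counting condition at `ω = lowerPow (w q)` gives a slot high enough for `q` that is not
    -- the chosen host of any page of `X` at least as heavy after rounding.
    obtain ⟨s, hs, hs'⟩ := exists_mem_notMem_of_card_lt_card
      (s := {x ∈ X | lowerPow (w q) ≤ lowerPow (w x)}.image ρ)
      (t := {s | s ∉ F ∧ lowerPow (w q) ≤ h s})
      (card_image_le.trans_lt (hall _ le_rfl))
    simp only [mem_filter, mem_univ, true_and] at hs
    have h1 : (stepCost w C (Function.update C s (some q)) : ℝ) ≤ 2 * lowerPow (w q) :=
      (NNReal.coe_le_coe.2 (stepCost_update_le w C s q)).trans (le_two_mul_lowerPow _)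
    have hupd : ∀ y ∈ X, ρ y ≠ s → Function.update C s (some q) (ρ y) = some y :=
      fun y hy hne => by rw [Function.update_of_ne hne, hρ y hy]
    by_cases hocc : ∃ x ∈ X, ρ x = s
    swap
    · refine ⟨Function.update C s (some q), ?_, ?_, ?_, ?_⟩
      · intro y hy
        rcases mem_insert.1 hy with rfl | hy
        · exact ⟨s, hs.1, by simp, hs.2⟩
        · exact ⟨ρ y, hρF y hy, hupd y hy fun hne => hocc ⟨y, hy, hne⟩, hρh y hy⟩
      · intro t ht
        have hts : t ≠ s := fun hts => hs.1 (hts ▸ ht)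
        exact Function.update_of_ne hts _ _
      · intro t p htp
        by_cases hts : t = s
        · subst hts; left; simpa using htp.symm
        · right; exact ⟨t, by rwa [Function.update_of_ne hts] at htp⟩
      · linarith [lowerPow_nonneg (w q)]
    obtain ⟨x, hx, rfl⟩ := hocc
    have hlt : lowerPow (w x) < lowerPow (w q) := by
      by_contra hcon
      exact hs' (mem_image_of_mem _ (mem_filter.2 ⟨hx, not_lt.1 hcon⟩))
    have hxmem : x ∈ {x ∈ X | lowerPow (w x) < lowerPow (w q)} := mem_filter.2 ⟨hx, hlt⟩
  -- With `n = 0` no page of `X` is lighter than `q`, so nothing could have been displaced.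
  · exact absurd (card_pos.2 ⟨x, hxmem⟩) (by omega)
  have hxq : x ≠ q := fun hxq => hq (hxq ▸ hx)
  have e1 : #{y ∈ insert q (X.erase x) | lowerPow (w y) < lowerPow (w x)} ≤ n := by
    have hsub : {y ∈ insert q (X.erase x) | lowerPow (w y) < lowerPow (w x)} ⊆
        {y ∈ X | lowerPow (w y) < lowerPow (w q)}.erase x := by
      intro y hy
      simp only [mem_filter, mem_insert, mem_erase] at hy ⊢
      rcases hy with ⟨rfl | hy, hyx⟩
      · exact absurd hyx (not_lt.2 hlt.le)
      · exact ⟨hy.1, hy.2, hyx.trans hlt⟩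
    have := card_le_card hsub
    rw [card_erase_of_mem hxmem] at this
    omega
  have e2 : x ∉ insert q (X.erase x) := by
    simp [hxq]
  have e3 : Hosts w h F (Function.update C (ρ x) (some q)) (insert q (X.erase x)) := by
    intro y hy
    rcases mem_insert.1 hy with rfl | hy
    · exact ⟨ρ x, hs.1, by simp, hs.2⟩
    · have hyX := mem_of_mem_erase hy
      exact ⟨ρ y, hρF y hyX, hupd y hyX fun hne => ne_of_mem_erase hy (hinj hyX hx hne),
        hρh y hyX⟩
  -- For these `ω` both `x` and `q` are counted, so exchanging them preserves the condition; it is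
  -- needed only up to the level of the page now to be placed.
  have e4 : ∀ ω ≤ lowerPow (w x),
      #{y ∈ insert q (X.erase x) | ω ≤ lowerPow (w y)} + 1 ≤ #{s | s ∉ F ∧ ω ≤ h s} := by
    intro ω hω
    refine le_trans (le_of_eq ?_) (hall ω (hω.trans hlt.le))
    rw [filter_insert, if_pos (hω.trans hlt.le), filter_erase,
      card_insert_of_notMem (fun hqx => hq (mem_filter.1 (mem_of_mem_erase hqx)).1),
      card_erase_add_one (mem_filter.2 ⟨hx, hω⟩)]
  obtain ⟨C', hC1, hC2, hC3, hC4⟩ := ih (insert q (X.erase x)) x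
    (Function.update C (ρ x) (some q)) e1 e2 e3 e4
  refine ⟨C', ?_, ?_, ?_, ?_⟩
  · intro y hy
    refine hC1 y ?_
    rcases mem_insert.1 hy with rfl | hy
    · simp
    · by_cases hyx : y = x <;> simp [hyx, hy]
  · intro t ht
    have hts : t ≠ ρ x := fun hts => hs.1 (hts ▸ ht)
    rw [hC2 t ht, Function.update_of_ne hts]
  · intro t p htp
    rcases hC3 t p htp with rfl | ⟨t', ht'⟩
    · exact Or.inr ⟨ρ p, hρ p hx⟩
    · by_cases hts : t' = ρ x
      · subst hts; left; simpa using ht'.symm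
      · right; exact ⟨t', by rwa [Function.update_of_ne hts] at ht'⟩
  · have h2 : (stepCost w C C' : ℝ) ≤ stepCost w C (Function.update C (ρ x) (some q))
        + stepCost w (Function.update C (ρ x) (some q)) C' := by
      exact_mod_cast stepCost_triangle w _ _ _
    -- Placing `q` costs at most `2 * lowerPow (w q)`, and the remaining chain at most `4 * lowerPow
    -- (w x)`, which is no more than `2 * lowerPow (w q)`.
    linarith [two_mul_lowerPow_le hlt]

end Insertion

/-! ### The potential and the collection of rent. -/

section Potential

variable {k : ℕ} {Page : Type*}

/-- The bookkeeping of the online algorithm: besides the cache, a height for each slot, a general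
credit for each page, a credit (the lease) for the page last requested specifically in a slot, and
the pages requested so far with their weights. -/
structure State (k : ℕ) (Page : Type*) where
  cache : Config k Page
  height : Fin k → ℝ
  credit : Page → ℝ
  lease : Fin k → ℝ
  weight : Page → ℝ≥0
  pages : Finset Page

/-- The height a slot must have to hold `p` after a general request. -/
noncomputable def State.level (st : State k Page) (p : Page) : ℝ := lowerPow (st.weight p)

open Classical in
/-- What the potential saves on slot `i` if the adversary keeps the given content there. -/
noncomputable def State.discount (st : State k Page) (i : Fin k) : Option Page → ℝ
  | none => 0
  | some p => st.credit p + min (st.level p) (st.height i) +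
      if st.cache i = some p then st.lease i else 0

lemma State.level_nonneg (st : State k Page) (p : Page) : 0 ≤ st.level p := lowerPow_nonneg _

lemma State.level_le (st : State k Page) (p : Page) : st.level p ≤ st.weight p := lowerPow_le _

/-- The part of the potential that does not depend on weights of pages not yet requested. -/
noncomputable def State.potential (st : State k Page) (C : Config k Page) : ℝ :=
  (5 * k - 1) * (∑ p ∈ st.pages, st.credit p + ∑ i, st.lease i) + 4 * ∑ i, st.height i
    - (5 * k + 4) * ∑ i, st.discount i (C i)

/-- The invariants of the state, where the pages of `E` need not be in the cache. -/
structure State.Valid (st : State k Page) (E : Set Page) : Prop where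
  height_nonneg : ∀ i, 0 ≤ st.height i
  credit_nonneg : ∀ p, 0 ≤ st.credit p
  lease_nonneg : ∀ i, 0 ≤ st.lease i
  credit_le : ∀ p, st.credit p ≤ st.weight p
  of_lease_pos : ∀ i, 0 < st.lease i →
    ∃ p, st.cache i = some p ∧ st.lease i ≤ st.weight p ∧ st.level p ≤ st.height i
  of_credit_pos : ∀ p ∉ E, 0 < st.credit p → ∃ i, st.cache i = some p ∧ st.level p ≤ st.height i
  weight_eq_zero : ∀ p ∉ st.pages, st.weight p = 0
  mem_pages : ∀ i p, st.cache i = some p → p ∈ st.pages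

/-- Credits have been lowered and heights raised, at no cost for an adversary that has served `r`. -/
structure State.Relaxes (r : Request k Page) (st st' : State k Page) : Prop where
  cache_eq : st'.cache = st.cache
  weight_eq : st'.weight = st.weight
  pages_eq : st'.pages = st.pages
  height_le : ∀ i, st.height i ≤ st'.height i
  credit_le : ∀ p, st'.credit p ≤ st.credit p
  lease_le : ∀ i, st'.lease i ≤ st.lease i
  credit_nonneg : (∀ p, 0 ≤ st.credit p) → ∀ p, 0 ≤ st'.credit p
  lease_nonneg : (∀ i, 0 ≤ st.lease i) → ∀ i, 0 ≤ st'.lease i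
  potential_le : ∀ C, Satisfies C r → st'.potential C ≤ st.potential C

lemma State.Relaxes.refl (r : Request k Page) (st : State k Page) : st.Relaxes r st :=
  ⟨rfl, rfl, rfl, fun _ => le_rfl, fun _ => le_rfl, fun _ => le_rfl, id, id, fun _ _ => le_rfl⟩

lemma State.Relaxes.trans {r : Request k Page} {st₁ st₂ st₃ : State k Page}
    (h : st₁.Relaxes r st₂) (h' : st₂.Relaxes r st₃) : st₁.Relaxes r st₃ where
  cache_eq := h'.cache_eq.trans h.cache_eq
  weight_eq := h'.weight_eq.trans h.weight_eq
  pages_eq := h'.pages_eq.trans h.pages_eq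
  height_le i := (h.height_le i).trans (h'.height_le i)
  credit_le p := (h'.credit_le p).trans (h.credit_le p)
  lease_le i := (h'.lease_le i).trans (h.lease_le i)
  credit_nonneg := h'.credit_nonneg ∘ h.credit_nonneg
  lease_nonneg := h'.lease_nonneg ∘ h.lease_nonneg
  potential_le C hC := (h'.potential_le C hC).trans (h.potential_le C hC)

lemma State.Relaxes.level_eq {r : Request k Page} {st st' : State k Page} (h : st.Relaxes r st')
    (p : Page) : st'.level p = st.level p := by
  simp [State.level, h.weight_eq]

lemma State.Relaxes.valid {r : Request k Page} {st st' : State k Page} (h : st.Relaxes r st')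
    {E : Set Page} (hst : st.Valid E) : st'.Valid E where
  height_nonneg i := (hst.height_nonneg i).trans (h.height_le i)
  credit_nonneg := h.credit_nonneg hst.credit_nonneg
  lease_nonneg := h.lease_nonneg hst.lease_nonneg
  credit_le p := by rw [h.weight_eq]; exact (h.credit_le p).trans (hst.credit_le p)
  of_lease_pos i hi := by
    obtain ⟨p, h1, h2, h3⟩ := hst.of_lease_pos i (hi.trans_le (h.lease_le i))
    exact ⟨p, by rw [h.cache_eq, h1], by rw [h.weight_eq]; exact (h.lease_le i).trans h2,
      by rw [h.level_eq]; exact h3.trans (h.height_le i)⟩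
  of_credit_pos p hp hp' := by
    obtain ⟨i, h1, h2⟩ := hst.of_credit_pos p hp (hp'.trans_le (h.credit_le p))
    exact ⟨i, by rw [h.cache_eq, h1], by rw [h.level_eq]; exact h2.trans (h.height_le i)⟩
  weight_eq_zero p hp := by rw [h.weight_eq]; exact hst.weight_eq_zero p (h.pages_eq ▸ hp)
  mem_pages i p hp := by rw [h.pages_eq]; exact hst.mem_pages i p (h.cache_eq ▸ hp)

open Classical in
/-- Lower the credits of the pages in `P` and the leases of the slots in `L` by `δ`, and raise the
heights of the slots in `E` by `δ`. -/
noncomputable def State.rent (st : State k Page) (P : Finset Page) (L E : Finset (Fin k)) (δ : ℝ) :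
    State k Page :=
  { st with
    height := fun i => st.height i + if i ∈ E then δ else 0
    credit := fun p => st.credit p - if p ∈ P then δ else 0
    lease := fun i => st.lease i - if i ∈ L then δ else 0 }

open Classical in
-- `N` contains the slots on which the adversary may lose discount. Each loses at most `δ`, since no
-- slot of `L` caches a page of `P`. Meanwhile at least `#N + 1` credits and leases fall.
lemma State.potential_rent_le (st : State k Page) {P : Finset Page} {L E N : Finset (Fin k)}
    {δ : ℝ} (hδ : 0 ≤ δ) (hP : P ⊆ st.pages)
    (hE : ∀ p ∈ P, ∀ i ∈ E, st.height i + δ ≤ st.level p) (hEL : Disjoint E L)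
    (hPL : ∀ p ∈ P, ∀ i ∈ L, st.cache i ≠ some p)
    (hcard : #N + 1 ≤ #P + #L) (hNE : #N + #E ≤ k) (hN : #N + 1 ≤ k) (C : Config k Page)
    (hCP : ∀ i ∉ E, ∀ p ∈ P, C i = some p → i ∈ N)
    (hCL : ∀ i ∈ L, st.cache i = C i → i ∈ N) :
    (st.rent P L E δ).potential C ≤ st.potential C := by
  have h1 : ∑ p ∈ st.pages, (st.rent P L E δ).credit p
      = ∑ p ∈ st.pages, st.credit p - #P * δ := by
    simp only [State.rent, sum_sub_distrib, sum_ite_mem, sum_const, nsmul_eq_mul,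
      inter_eq_right.2 hP]
  have h2 : ∑ i, (st.rent P L E δ).lease i = ∑ i, st.lease i - #L * δ := by
    simp only [State.rent, sum_sub_distrib, sum_ite_mem, sum_const, nsmul_eq_mul, univ_inter]
  have h3 : ∑ i, (st.rent P L E δ).height i = ∑ i, st.height i + #E * δ := by
    simp only [State.rent, sum_add_distrib, sum_ite_mem, sum_const, nsmul_eq_mul, univ_inter]
  have h4 : ∑ i, st.discount i (C i) ≤ ∑ i, (st.rent P L E δ).discount i (C i) + #N * δ := by
    have : (#N : ℝ) * δ = ∑ i : Fin k, if i ∈ N then δ else 0 := by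
      simp only [sum_ite_mem, sum_const, nsmul_eq_mul, univ_inter]
    rw [this, ← sum_add_distrib]
    refine sum_le_sum fun i _ => ?_
    cases hC : C i with
    | none => simp only [State.discount]; split_ifs <;> linarith
    | some p =>
      have hd : (st.rent P L E δ).discount i (some p) =
          (st.credit p - if p ∈ P then δ else 0) +
            min (st.level p) (st.height i + if i ∈ E then δ else 0) +
            if st.cache i = some p then st.lease i - if i ∈ L then δ else 0 else 0 := rfl
      have hd' : st.discount i (some p) = st.credit p + min (st.level p) (st.height i) +
            if st.cache i = some p then st.lease i else 0 := rfl
      rw [hd, hd']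
      have hmin : min (st.level p) (st.height i) ≤
          min (st.level p) (st.height i + if i ∈ E then δ else 0) :=
        min_le_min le_rfl (by split_ifs <;> linarith)
      by_cases hp : p ∈ P
      · have hnl : i ∈ L → st.cache i ≠ some p := hPL p hp i
        by_cases hiE : i ∈ E
        · have hiL : i ∉ L := disjoint_left.1 hEL hiE
          -- In a raised slot, the minimum of level and height grows by exactly the `δ` that the
          -- credit loses.
          have h5 := hE p hp i hiE
          rw [if_pos hp, if_neg hiL, if_pos hiE, min_eq_right h5, min_eq_right (by linarith)]
          split_ifs <;> linarith
        · rw [if_pos (hCP i hiE p hp hC)]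
          by_cases hiL : i ∈ L
          · rw [if_neg (hnl hiL), if_pos hp, if_neg (hnl hiL)]
            linarith
          · rw [if_pos hp, if_neg hiL]
            split_ifs at * <;> linarith
      · rw [if_neg hp]
        by_cases hc : st.cache i = some p
        · by_cases hiL : i ∈ L
          · rw [if_pos (hCL i hiL (by rw [hc, hC])), if_pos hiL]
            split_ifs at * <;> linarith
          · rw [if_neg hiL]
            split_ifs at * <;> linarith
        · rw [if_neg hc, if_neg hc]
          split_ifs at * <;> linarith
  have hp : (st.rent P L E δ).pages = st.pages := rfl
  unfold State.potential
  rw [hp, h1, h2, h3]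
  have hk : (1 : ℝ) ≤ k := by exact_mod_cast (by omega : 1 ≤ k)
  have hcard' : (#N : ℝ) + 1 ≤ #P + #L := by exact_mod_cast hcard
  have hNE' : (#N : ℝ) + #E ≤ k := by exact_mod_cast hNE
  have hN' : (#N : ℝ) + 1 ≤ k := by exact_mod_cast hN
  have h6 : (5 * (k : ℝ) - 1) * (#N + 1) ≤ (5 * k - 1) * (#P + #L) :=
    mul_le_mul_of_nonneg_left hcard' (by linarith)
  -- After `h6` the slack is `5k - 1 - 5 #N - 4 #E`; by `#N + #E ≤ k` it is at least `k - 1 - #N`,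
  -- hence nonnegative. This is what fixes the coefficients of the potential.
  have h7 : (5 * (k : ℝ) + 4) * #N + 4 * #E ≤ (5 * k - 1) * (#P + #L) := by linarith
  have h8 := mul_le_mul_of_nonneg_right h7 hδ
  have h9 := mul_le_mul_of_nonneg_left h4 (by linarith : (0 : ℝ) ≤ 5 * k + 4)
  linarith

open Classical in
/-- The number of credits and leases that are positive and of slots too low for a page. -/
noncomputable def State.measure (st : State k Page) : ℕ :=
  #{p ∈ st.pages | 0 < st.credit p} + #{i | 0 < st.lease i} +
    #{x ∈ st.pages ×ˢ univ | st.height x.2 < st.level x.1}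

theorem State.exists_relaxes_measure_lt {st : State k Page} (r : Request k Page)
    {P : Finset Page} {L E : Finset (Fin k)} (hP : P ⊆ st.pages)
    (hPpos : ∀ p ∈ P, 0 < st.credit p) (hLpos : ∀ i ∈ L, 0 < st.lease i)
    (hE : ∀ p ∈ P, ∀ i ∈ E, st.height i < st.level p) (hEL : Disjoint E L)
    (hPL : ∀ p ∈ P, ∀ i ∈ L, st.cache i ≠ some p)
    (hN : ∀ C, Satisfies C r → ∃ N : Finset (Fin k), #N + 1 ≤ #P + #L ∧ #N + #E ≤ k ∧ #N + 1 ≤ k ∧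
      (∀ i ∉ E, ∀ p ∈ P, C i = some p → i ∈ N) ∧ ∀ i ∈ L, st.cache i = C i → i ∈ N)
    (hne : P.Nonempty ∨ L.Nonempty) :
    ∃ st', st.Relaxes r st' ∧ st'.measure < st.measure := by
  classical
  -- The amounts at which a credit or lease is used up or a slot reaches a level. Taking `δ` to be
  -- their minimum keeps everything in range and makes at least one such event happen.
  let V : Finset ℝ := P.image st.credit ∪ L.image st.lease ∪
    (P ×ˢ E).image fun x => st.level x.1 - st.height x.2
  have hV : V.Nonempty := by
    rcases hne with ⟨p, hp⟩ | ⟨i, hi⟩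
    · exact ⟨st.credit p, by simp only [V, mem_union]; exact Or.inl (Or.inl (mem_image_of_mem _ hp))⟩
    · exact ⟨st.lease i, by simp only [V, mem_union]; exact Or.inl (Or.inr (mem_image_of_mem _ hi))⟩
  obtain ⟨δ, hδV, hmin⟩ : ∃ δ ∈ V, ∀ x ∈ V, δ ≤ x := ⟨V.min' hV, V.min'_mem hV, fun x => V.min'_le x⟩
  have hδP : ∀ p ∈ P, δ ≤ st.credit p := fun p hp => hmin _ <| by
    simp only [V, mem_union]; exact Or.inl (Or.inl (mem_image_of_mem _ hp))
  have hδL : ∀ i ∈ L, δ ≤ st.lease i := fun i hi => hmin _ <| by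
    simp only [V, mem_union]; exact Or.inl (Or.inr (mem_image_of_mem _ hi))
  have hδE : ∀ p ∈ P, ∀ i ∈ E, δ ≤ st.level p - st.height i := fun p hp i hi => hmin _ <| by
    simp only [V, mem_union]
    exact Or.inr (mem_image.2 ⟨(p, i), mem_product.2 ⟨hp, hi⟩, rfl⟩)
  have hδ : 0 < δ := by
    simp only [V, mem_union, mem_image, mem_product] at hδV
    rcases hδV with (⟨p, hp, rfl⟩ | ⟨i, hi, rfl⟩) | ⟨⟨p, i⟩, ⟨hp, hi⟩, rfl⟩
    · exact hPpos p hp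
    · exact hLpos i hi
    · exact sub_pos.2 (hE p hp i hi)
  have hrel : st.Relaxes r (st.rent P L E δ) := by
    refine ⟨rfl, rfl, rfl, fun i => ?_, fun p => ?_, fun i => ?_, fun h p => ?_, fun h i => ?_,
      fun C hC => ?_⟩
    · simp only [State.rent]; split_ifs <;> linarith
    · simp only [State.rent]; split_ifs <;> linarith
    · simp only [State.rent]; split_ifs <;> linarith
    · simp only [State.rent]; split_ifs with hp
      · linarith [hδP p hp]
      · linarith [h p]
    · simp only [State.rent]; split_ifs with hi
      · linarith [hδL i hi]
      · linarith [h i]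
    · obtain ⟨N, h1, h2, h3, h4, h5⟩ := hN C hC
      exact st.potential_rent_le hδ.le hP (fun p hp i hi => by linarith [hδE p hp i hi]) hEL hPL
        h1 h2 h3 C h4 h5
  refine ⟨_, hrel, ?_⟩
  have s1 : ({p ∈ st.pages | 0 < (st.rent P L E δ).credit p} : Finset Page) ⊆
      {p ∈ st.pages | 0 < st.credit p} :=
    monotone_filter_right _ fun p _ hp => lt_of_lt_of_le hp (hrel.credit_le p)
  have s2 : ({i | 0 < (st.rent P L E δ).lease i} : Finset (Fin k)) ⊆
      ({i | 0 < st.lease i} : Finset (Fin k)) :=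
    monotone_filter_right _ fun p _ hp => lt_of_lt_of_le hp (hrel.lease_le p)
  have s3 : {x ∈ st.pages ×ˢ (univ : Finset (Fin k)) |
        (st.rent P L E δ).height x.2 < (st.rent P L E δ).level x.1} ⊆
      {x ∈ st.pages ×ˢ (univ : Finset (Fin k)) | st.height x.2 < st.level x.1} :=
    monotone_filter_right _ fun p _ hp => lt_of_le_of_lt (hrel.height_le _) hp
  have c1 := card_le_card s1
  have c2 := card_le_card s2
  have c3 := card_le_card s3
  unfold State.measure
  rw [hrel.pages_eq]
  simp only [V, mem_union, mem_image, mem_product] at hδV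
  rcases hδV with (⟨p, hp, hpδ⟩ | ⟨i, hi, hiδ⟩) | ⟨⟨p, i⟩, ⟨hp, hi⟩, hpi⟩
  · have := card_lt_card ((ssubset_iff_of_subset s1).2
      ⟨p, mem_filter.2 ⟨hP hp, hPpos p hp⟩, by simp [State.rent, hp, hpδ]⟩)
    omega
  · have := card_lt_card ((ssubset_iff_of_subset s2).2
      ⟨i, mem_filter.2 ⟨mem_univ i, hLpos i hi⟩, by simp [State.rent, hi, hiδ]⟩)
    omega
  · have hnot : ¬ (st.rent P L E δ).height i < (st.rent P L E δ).level p := by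
      have hl : (st.rent P L E δ).level p = st.level p := rfl
      have hh : (st.rent P L E δ).height i = st.height i + δ := by simp [State.rent, hi]
      simp only at hpi
      rw [hl, hh]
      linarith
    have := card_lt_card ((ssubset_iff_of_subset s3).2
      ⟨(p, i), mem_filter.2 ⟨mem_product.2 ⟨hP hp, mem_univ _⟩, hE p hp i hi⟩,
        fun h => hnot (mem_filter.1 h).2⟩)
    omega

/-- Relaxing a state repeatedly removes any condition under which it can be relaxed further. -/
theorem State.exists_relaxes_not {r : Request k Page} (V : State k Page → Prop) (st : State k Page)
    (hV : ∀ st₁, st.Relaxes r st₁ → V st₁ → ∃ st₂, st₁.Relaxes r st₂ ∧ st₂.measure < st₁.measure) :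
    ∃ st', st.Relaxes r st' ∧ ¬ V st' := by
  by_contra! hcon
  have key : ∀ n, ∀ st₁, st.Relaxes r st₁ → st₁.measure ≤ n → False := by
    intro n
    induction n with
    | zero =>
      intro st₁ h1 hn
      obtain ⟨st₂, -, h2⟩ := hV st₁ h1 (hcon st₁ h1)
      omega
    | succ n ih =>
      intro st₁ h1 hn
      obtain ⟨st₂, h2, h3⟩ := hV st₁ h1 (hcon st₁ h1)
      exact ih st₂ (h1.trans h2) (by omega)
  exact key _ st (State.Relaxes.refl r st) le_rfl

end Potential

/-! ### Serving one request. -/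

section Step

variable {k : ℕ} {Page : Type*}

open Classical in
/-- The slots outside `J` with a positive lease. -/
noncomputable def State.leased (st : State k Page) (J : Finset (Fin k)) : Finset (Fin k) :=
  {i | i ∉ J ∧ 0 < st.lease i}

open Classical in
/-- The pages other than `q` with positive credit that no leased slot outside `J` holds. -/
noncomputable def State.active (st : State k Page) (J : Finset (Fin k)) (q : Page) : Finset Page :=
  {p ∈ st.pages | p ≠ q ∧ 0 < st.credit p ∧ ∀ i ∈ st.leased J, st.cache i ≠ some p}

lemma State.mem_leased {st : State k Page} {J : Finset (Fin k)} {i : Fin k} :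
    i ∈ st.leased J ↔ i ∉ J ∧ 0 < st.lease i := by
  simp [State.leased]

lemma State.mem_active {st : State k Page} {J : Finset (Fin k)} {q p : Page} :
    p ∈ st.active J q ↔
      p ∈ st.pages ∧ p ≠ q ∧ 0 < st.credit p ∧ ∀ i ∈ st.leased J, st.cache i ≠ some p := by
  simp [State.active]

lemma State.Valid.mem_pages_of_credit_pos {st : State k Page} {E : Set Page} (hst : st.Valid E)
    {p : Page} (hp : 0 < st.credit p) : p ∈ st.pages := by
  by_contra hcon
  have := hst.credit_le p
  rw [hst.weight_eq_zero p hcon] at this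
  exact absurd hp (not_lt.2 this)

lemma State.Valid.mono {st : State k Page} {E E' : Set Page} (hst : st.Valid E) (h : E ⊆ E') :
    st.Valid E' :=
  { hst with of_credit_pos := fun p hp => hst.of_credit_pos p fun hp' => hp (h hp') }

lemma State.Valid.hosts {st : State k Page} {q : Page} (hst : st.Valid {q})
    (J : Finset (Fin k)) :
    Hosts st.weight st.height (st.leased J) st.cache (st.active J q) := by
  intro p hp
  obtain ⟨-, h2, h3, h4⟩ := State.mem_active.1 hp
  obtain ⟨i, hi, hi'⟩ := hst.of_credit_pos p h2 h3
  exact ⟨i, fun h => h4 i h hi, hi, hi'⟩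

open Classical in
-- The adversary spends a slot on `q`, which is neither active nor cached. At most `k - 1` of its
-- slots can honour credits or leases, so rent on `k` or more of them is free and no height need
-- rise.
theorem State.exists_relaxes_room (st : State k Page) (hk : 1 ≤ k) {q : Page}
    (hq : ∀ i, st.cache i ≠ some q) :
    ∃ st', st.Relaxes ⟨q, .general⟩ st' ∧ #(st'.active ∅ q) + #(st'.leased ∅) < k := by
  refine (State.exists_relaxes_not (r := ⟨q, .general⟩)
    (fun st' => k ≤ #(st'.active ∅ q) + #(st'.leased ∅)) st ?_).imp
    fun st' h => ⟨h.1, not_le.1 h.2⟩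
  intro st₁ h₁ hV
  refine State.exists_relaxes_measure_lt (P := st₁.active ∅ q) (L := st₁.leased ∅) (E := ∅) _
    (fun p hp => (State.mem_active.1 hp).1) (fun p hp => (State.mem_active.1 hp).2.2.1)
    (fun i hi => (State.mem_leased.1 hi).2) (by simp) (by simp)
    (fun p hp i hi => (State.mem_active.1 hp).2.2.2 i hi) ?_ ?_
  · rintro C ⟨s, -, hs⟩
    have hcard : #(univ.erase s) + 1 = k := by
      rw [card_erase_add_one (mem_univ s), card_univ, Fintype.card_fin]
    refine ⟨univ.erase s, by omega, by simp, by omega, ?_, ?_⟩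
    · rintro i - p hp hi
      refine mem_erase.2 ⟨?_, mem_univ _⟩
      rintro rfl
      exact (State.mem_active.1 hp).2.1 (Option.some.inj (hi.symm.trans hs))
    · intro i _ hi
      refine mem_erase.2 ⟨?_, mem_univ _⟩
      rintro rfl
      rw [h₁.cache_eq] at hi
      exact hq i (hi.trans hs)
  · by_contra! hcon
    rw [hcon.1, hcon.2] at hV
    simp at hV
    omega

open Classical in
-- If the counting condition fails at `ω`, then `q`, the active pages of level at least `ω` and the
-- leased slots of height at least `ω` outnumber the slots of height at least `ω`. Rent is collected
-- from them and the lower slots rise.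
theorem State.Valid.exists_relaxes_insertable {st : State k Page} {q : Page} (hst : st.Valid {q})
    (r : Request k Page) (hqp : q ∈ st.pages) {f : Fin k} (hf : st.cache f = some q)
    (hq : ∀ i, st.cache i = some q → st.lease i ≤ 0) :
    ∃ st', st.Relaxes r st' ∧ (0 < st'.credit q → ∀ ω ≤ st'.level q,
      #{x ∈ st'.active ∅ q | ω ≤ st'.level x} + 1 ≤
        #{i | i ∉ st'.leased ∅ ∧ ω ≤ st'.height i}) := by
  refine (State.exists_relaxes_not (r := r)
    (fun st' => 0 < st'.credit q ∧ ∃ ω ≤ st'.level q,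
      #{i | i ∉ st'.leased ∅ ∧ ω ≤ st'.height i} <
        #{x ∈ st'.active ∅ q | ω ≤ st'.level x} + 1) st ?_).imp
    fun st' h => ⟨h.1, by have h' := h.2; push Not at h'; exact h'⟩
  rintro st₁ h₁ ⟨hpos, ω, hω, hlt⟩
  have hst₁ := h₁.valid hst
  have hq₁ : ∀ i ∈ st₁.leased ∅, st₁.cache i ≠ some q := fun i hi hi' =>
    absurd ((State.mem_leased.1 hi).2.trans_le (h₁.lease_le i))
      (not_lt.2 (hq i (by rw [← h₁.cache_eq, hi'])))
  have hf₁ : st₁.cache f = some q := by rw [h₁.cache_eq, hf]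
  -- Were `f` high enough, it and the distinct hosts of the active pages would witness the counting
  -- condition. So some slot is below `ω`, as `#N + 1 ≤ k` requires.
  have hfN : ¬ ω ≤ st₁.height f := by
    intro hωf
    have hH := hst₁.hosts ∅
    have : Nonempty (Fin k) := ⟨f⟩
    choose! ρ hρF hρ hρh using hH
    have hinj : Set.InjOn ρ (({x ∈ st₁.active ∅ q | ω ≤ st₁.level x} : Finset Page) : Set Page) := by
      intro x hx y hy hxy
      have hx' := hρ x (mem_filter.1 hx).1
      rw [hxy, hρ y (mem_filter.1 hy).1] at hx'
      exact (Option.some.inj hx').symm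
    have hfρ : f ∉ ({x ∈ st₁.active ∅ q | ω ≤ st₁.level x}).image ρ := by
      intro hmem
      obtain ⟨x, hx, hxf⟩ := mem_image.1 hmem
      have hx' := hρ x (mem_filter.1 hx).1
      rw [hxf, hf₁] at hx'
      exact (State.mem_active.1 (mem_filter.1 hx).1).2.1 (Option.some.inj hx').symm
    have hsub : insert f (({x ∈ st₁.active ∅ q | ω ≤ st₁.level x}).image ρ) ⊆
        ({i | i ∉ st₁.leased ∅ ∧ ω ≤ st₁.height i} : Finset (Fin k)) := by
      intro i hi
      rw [mem_filter]
      refine ⟨mem_univ _, ?_⟩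
      rcases mem_insert.1 hi with rfl | hi
      · exact ⟨fun h => hq₁ i h hf₁, hωf⟩
      · obtain ⟨x, hx, rfl⟩ := mem_image.1 hi
        obtain ⟨hx1, hx2⟩ := mem_filter.1 hx
        exact ⟨hρF x hx1, hx2.trans (hρh x hx1)⟩
    have := card_le_card hsub
    rw [card_insert_of_notMem hfρ, card_image_of_injOn hinj] at this
    omega
  have hqP : q ∉ ({x ∈ st₁.active ∅ q | ω ≤ st₁.level x} : Finset Page) := fun h =>
    (State.mem_active.1 (mem_filter.1 h).1).2.1 rfl
  have hN : #{i | ω ≤ st₁.height i} = #{i ∈ st₁.leased ∅ | ω ≤ st₁.height i} +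
      #{i | i ∉ st₁.leased ∅ ∧ ω ≤ st₁.height i} := by
    rw [← card_filter_add_card_filter_not (s := {i | ω ≤ st₁.height i})
      (fun i => i ∈ st₁.leased ∅)]
    congr 2 <;> ext i <;> simp [and_comm]
  have hNE : #{i | ω ≤ st₁.height i} + #{i | st₁.height i < ω} = k := by
    have := card_filter_add_card_filter_not (s := (univ : Finset (Fin k)))
      (fun i => ω ≤ st₁.height i)
    simpa using this
  have hNk : #{i | ω ≤ st₁.height i} + 1 ≤ k := by
    have : 0 < #{i | st₁.height i < ω} :=
      card_pos.2 ⟨f, mem_filter.2 ⟨mem_univ _, not_le.1 hfN⟩⟩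
    omega
  refine State.exists_relaxes_measure_lt
    (P := insert q {x ∈ st₁.active ∅ q | ω ≤ st₁.level x})
    (L := {i ∈ st₁.leased ∅ | ω ≤ st₁.height i}) (E := {i | st₁.height i < ω}) r
    ?_ ?_ ?_ ?_ ?_ ?_ ?_ (Or.inl (insert_nonempty _ _))
  · intro p hp
    rcases mem_insert.1 hp with rfl | hp
    · rw [h₁.pages_eq]; exact hqp
    · exact (State.mem_active.1 (mem_filter.1 hp).1).1
  · intro p hp
    rcases mem_insert.1 hp with rfl | hp
    · exact hpos
    · exact (State.mem_active.1 (mem_filter.1 hp).1).2.2.1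
  · exact fun i hi => (State.mem_leased.1 (mem_filter.1 hi).1).2
  · intro p hp i hi
    refine (mem_filter.1 hi).2.trans_le ?_
    rcases mem_insert.1 hp with rfl | hp
    · exact hω
    · exact (mem_filter.1 hp).2
  · rw [disjoint_left]
    exact fun i hi hi' => absurd (mem_filter.1 hi').2 (not_le.2 (mem_filter.1 hi).2)
  · intro p hp i hi
    rcases mem_insert.1 hp with rfl | hp
    · exact hq₁ i (mem_filter.1 hi).1
    · exact (State.mem_active.1 (mem_filter.1 hp).1).2.2.2 i (mem_filter.1 hi).1
  · intro C _
    refine ⟨({i | ω ≤ st₁.height i} : Finset (Fin k)), ?_, hNE.le, hNk, ?_, ?_⟩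
    · rw [card_insert_of_notMem hqP]
      omega
    · intro i hi _ _ _
      simpa using hi
    · intro i hi _
      exact mem_filter.2 ⟨mem_univ _, (mem_filter.1 hi).2⟩

open Classical in
-- The adversary holds `p` in slot `j`, so `j` honours nothing active or leased. If the counting
-- condition fails at `ω`, only the other slots of height at least `ω` can lose discount, and they
-- are too few.
theorem State.exists_relaxes_vacatable (st : State k Page) (p : Page) (j : Fin k) :
    ∃ st', st.Relaxes ⟨p, .specific j⟩ st' ∧ ∀ ω,
      #{x ∈ st'.active {j} p | ω ≤ st'.level x} ≤
        #{i | i ∉ insert j (st'.leased {j}) ∧ ω ≤ st'.height i} := by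
  refine (State.exists_relaxes_not (r := ⟨p, .specific j⟩)
    (fun st' => ∃ ω, #{i | i ∉ insert j (st'.leased {j}) ∧ ω ≤ st'.height i} <
      #{x ∈ st'.active {j} p | ω ≤ st'.level x}) st ?_).imp
    fun st' h => ⟨h.1, by have h' := h.2; push Not at h'; exact h'⟩
  rintro st₁ h₁ ⟨ω, hlt⟩
  have hN : #{i | i ≠ j ∧ ω ≤ st₁.height i} = #{i ∈ st₁.leased {j} | ω ≤ st₁.height i} +
      #{i | i ∉ insert j (st₁.leased {j}) ∧ ω ≤ st₁.height i} := by
    rw [← card_filter_add_card_filter_not (s := {i | i ≠ j ∧ ω ≤ st₁.height i})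
      (fun i => i ∈ st₁.leased {j})]
    congr 2 <;> ext i <;> simp [State.mem_leased] <;> tauto
  have hNE : #{i | i ≠ j ∧ ω ≤ st₁.height i} + #{i | i ≠ j ∧ st₁.height i < ω} + 1 = k := by
    have h1 : (univ.erase j : Finset (Fin k)) = ({i | i ≠ j} : Finset (Fin k)) := by
      ext i; simp
    have h2 : #({i | i ≠ j} : Finset (Fin k)) + 1 = k := by
      rw [← h1, card_erase_add_one (mem_univ j), card_univ, Fintype.card_fin]
    have h3 := card_filter_add_card_filter_not (s := ({i | i ≠ j} : Finset (Fin k)))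
      (fun i => ω ≤ st₁.height i)
    simp only [filter_filter, not_le] at h3
    omega
  refine State.exists_relaxes_measure_lt (P := {x ∈ st₁.active {j} p | ω ≤ st₁.level x})
    (L := {i ∈ st₁.leased {j} | ω ≤ st₁.height i}) (E := {i | i ≠ j ∧ st₁.height i < ω}) _
    ?_ ?_ ?_ ?_ ?_ ?_ ?_ (Or.inl (card_pos.1 (by omega)))
  · exact fun x hx => (State.mem_active.1 (mem_filter.1 hx).1).1
  · exact fun x hx => (State.mem_active.1 (mem_filter.1 hx).1).2.2.1
  · exact fun i hi => (State.mem_leased.1 (mem_filter.1 hi).1).2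
  · exact fun x hx i hi => (mem_filter.1 hi).2.2.trans_le (mem_filter.1 hx).2
  · rw [disjoint_left]
    exact fun i hi hi' => absurd (mem_filter.1 hi').2 (not_le.2 (mem_filter.1 hi).2.2)
  · exact fun x hx i hi => (State.mem_active.1 (mem_filter.1 hx).1).2.2.2 i (mem_filter.1 hi).1
  · rintro C ⟨s, hs, hCs⟩
    obtain rfl : s = j := by simpa [SlotSpec.slots] using hs
    refine ⟨({i | i ≠ s ∧ ω ≤ st₁.height i} : Finset (Fin k)), by omega, by omega, by omega, ?_, ?_⟩
    · intro i hi x hx hix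
      have his : i ≠ s := by
        rintro rfl
        exact (State.mem_active.1 (mem_filter.1 hx).1).2.1 (Option.some.inj (hix.symm.trans hCs))
      simp only [mem_filter, mem_univ, true_and, not_and, not_lt] at hi ⊢
      exact ⟨his, hi his⟩
    · intro i hi _
      obtain ⟨hi1, hi2⟩ := mem_filter.1 hi
      exact mem_filter.2 ⟨mem_univ _, by simpa using (State.mem_leased.1 hi1).1, hi2⟩

open Classical in
lemma State.discount_some (st : State k Page) (i : Fin k) (p : Page) :
    st.discount i (some p) = st.credit p + min (st.level p) (st.height i) +
      if st.cache i = some p then st.lease i else 0 := by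
  unfold State.discount
  congr

/-- The requirements on the state after a request `r` to a page that is already recorded. -/
structure State.Serves (r : Request k Page) (st st' : State k Page) : Prop where
  valid : st'.Valid ∅
  weight_eq : st'.weight = st.weight
  pages_eq : st'.pages = st.pages
  satisfies : Satisfies st'.cache r
  potential_le : ∀ C, Satisfies C r →
    st'.potential C + stepCost st.weight st.cache st'.cache ≤ st.potential C

/-- The potential does not depend on the pages in slots without a lease. -/
lemma State.potential_congr_cache {st : State k Page} {D : Config k Page}
    (h : ∀ i, st.lease i ≠ 0 → D i = st.cache i) (C : Config k Page) :
    State.potential { st with cache := D } C = st.potential C := by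
  unfold State.potential
  congr 2
  refine sum_congr rfl fun i _ => ?_
  cases C i with
  | none => rfl
  | some p =>
    rw [State.discount_some, State.discount_some]
    congr 1
    by_cases hi : st.lease i = 0
    · simp [hi]
    · have hDi := h i hi
      by_cases hc : st.cache i = some p
      · rw [if_pos hc, if_pos (hDi.trans hc)]
      · rw [if_neg hc, if_neg fun h' => hc (hDi.symm.trans h')]

open Classical in
/-- The state in which `q`, with full credit, has been put into slot `f`. -/
noncomputable def State.admit (st : State k Page) (q : Page) (f : Fin k) : State k Page :=
  { st with
    cache := Function.update st.cache f (some q)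
    credit := Function.update st.credit q (st.weight q) }

open Classical in
-- The new credit adds `(5k-1) w(q)`, and the adversary, who holds `q` somewhere, gains a discount
-- worth at least `(5k+4) w(q)`.
lemma State.potential_admit_le {st : State k Page} {q : Page} {f : Fin k} (hqp : q ∈ st.pages)
    (hq : st.credit q = 0) (hf : st.lease f = 0) {C : Config k Page}
    (hC : Satisfies C ⟨q, .general⟩) :
    (st.admit q f).potential C + 5 * st.weight q ≤ st.potential C := by
  obtain ⟨i₀, -, hi₀⟩ := hC
  have h0 : (st.admit q f).potential C =
      State.potential { st with credit := Function.update st.credit q (st.weight q) } C := by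
    refine State.potential_congr_cache
      (st := { st with credit := Function.update st.credit q (st.weight q) }) (fun i hi => ?_) C
    have hif : i ≠ f := fun hif => hi (hif ▸ hf)
    exact Function.update_of_ne hif _ _
  have hcr : ∀ p, Function.update st.credit q (st.weight q : ℝ) p =
      st.credit p + if p = q then (st.weight q : ℝ) else 0 := by
    intro p
    by_cases hp : p = q
    · subst hp; simp [hq]
    · simp [hp]
  have h1 : ∑ p ∈ st.pages, Function.update st.credit q (st.weight q : ℝ) p =
      ∑ p ∈ st.pages, st.credit p + st.weight q := by
    simp only [hcr, sum_add_distrib, sum_ite_eq', if_pos hqp]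
  have h2 : ∑ i, st.discount i (C i) + st.weight q ≤ ∑ i, State.discount
      { st with credit := Function.update st.credit q (st.weight q) } i (C i) := by
    have h3 : (st.weight q : ℝ) = ∑ i : Fin k, if i = i₀ then (st.weight q : ℝ) else 0 := by simp
    conv_lhs => rw [h3, ← sum_add_distrib]
    refine sum_le_sum fun i _ => ?_
    cases hCi : C i with
    | none =>
      have : i ≠ i₀ := by rintro rfl; simp [hi₀] at hCi
      simp [this, State.discount]
    | some p =>
      have hd : State.discount { st with credit := Function.update st.credit q (st.weight q) } i
          (some p) = Function.update st.credit q (st.weight q : ℝ) p +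
            min (st.level p) (st.height i) + if st.cache i = some p then st.lease i else 0 :=
        State.discount_some _ _ _
      rw [hd, State.discount_some, hcr]
      by_cases hi : i = i₀
      · subst hi
        obtain rfl : p = q := Option.some.inj (hCi.symm.trans hi₀)
        simp only [if_true]
        linarith
      · have : (0 : ℝ) ≤ if p = q then (st.weight q : ℝ) else 0 := by
          split_ifs <;> simp
        rw [if_neg hi]
        linarith
  rw [h0]
  have h4 := mul_le_mul_of_nonneg_left h2 (by positivity : (0 : ℝ) ≤ 5 * k + 4)
  unfold State.potential
  dsimp only
  rw [h1]
  linarith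

open Classical in
theorem State.Valid.exists_serves_general {st : State k Page} (hst : st.Valid ∅) (hk : 1 ≤ k)
    {q : Page} (hqp : q ∈ st.pages) (hq : ∀ i, st.cache i ≠ some q) :
    ∃ st', st.Serves ⟨q, .general⟩ st' := by
  obtain ⟨st₂, h₂, hroom⟩ := st.exists_relaxes_room hk hq
  have hv₂ := h₂.valid hst
  have hq₂ : ∀ i, st₂.cache i ≠ some q := fun i => by rw [h₂.cache_eq]; exact hq i
  have hqp₂ : q ∈ st₂.pages := by rw [h₂.pages_eq]; exact hqp
  have hcq : st₂.credit q = 0 := by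
    refine le_antisymm (not_lt.1 fun hpos => ?_) (hv₂.credit_nonneg q)
    obtain ⟨i, hi, -⟩ := hv₂.of_credit_pos q (by simp) hpos
    exact hq₂ i hi
  have hH := (hv₂.mono (Set.empty_subset {q})).hosts ∅
  have : Nonempty (Fin k) := ⟨⟨0, hk⟩⟩
  choose! ρ hρF hρ hρh using hH
  -- A slot that is neither leased nor the chosen host of an active page. It may be too low for `q`,
  -- so validity is claimed only up to `{q}` at first.
  obtain ⟨f, -, hf⟩ := exists_mem_notMem_of_card_lt_card
    (s := (st₂.active ∅ q).image ρ ∪ st₂.leased ∅) (t := univ) <| by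
      refine (card_union_le _ _).trans_lt ?_
      rw [card_univ, Fintype.card_fin]
      exact (Nat.add_le_add_right card_image_le _).trans_lt hroom
  simp only [mem_union, not_or] at hf
  have hfl : st₂.lease f = 0 :=
    le_antisymm (not_lt.1 fun h => hf.2 (State.mem_leased.2 ⟨by simp, h⟩)) (hv₂.lease_nonneg f)
  have hpot₃ : ∀ C, Satisfies C ⟨q, .general⟩ →
      (st₂.admit q f).potential C + 5 * st₂.weight q ≤ st₂.potential C :=
    fun C hC => State.potential_admit_le hqp₂ hcq hfl hC
  have hv₃ : (st₂.admit q f).Valid {q} := by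
    refine ⟨hv₂.height_nonneg, fun p => ?_, hv₂.lease_nonneg, fun p => ?_, fun i hi => ?_,
      fun p hp hp' => ?_, hv₂.weight_eq_zero, fun i p hi => ?_⟩
    · by_cases hp : p = q
      · subst hp; simp [State.admit]
      · simpa [State.admit, hp] using hv₂.credit_nonneg p
    · by_cases hp : p = q
      · subst hp; simp [State.admit]
      · simpa [State.admit, hp] using hv₂.credit_le p
    · have hif : i ≠ f := fun hif => (hif ▸ hi : 0 < st₂.lease f).ne' hfl
      obtain ⟨p, hp⟩ := hv₂.of_lease_pos i hi
      exact ⟨p, by simpa [State.admit, hif] using hp.1, hp.2⟩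
    · have hpq : p ≠ q := hp
      have hpos : 0 < st₂.credit p := by simpa [State.admit, hpq] using hp'
      by_cases hact : p ∈ st₂.active ∅ q
      · have hpf : ρ p ≠ f := fun h => hf.1 (h ▸ mem_image_of_mem _ hact)
        exact ⟨ρ p, by simpa [State.admit, hpf] using hρ p hact, hρh p hact⟩
      · have : ∃ i ∈ st₂.leased ∅, st₂.cache i = some p := by
          by_contra! hcon
          exact hact (State.mem_active.2 ⟨hv₂.mem_pages_of_credit_pos hpos, hpq, hpos, hcon⟩)
        obtain ⟨i, hi, hip⟩ := this
        have hif : i ≠ f := fun h => hf.2 (h ▸ hi)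
        obtain ⟨p', hp', -, hlev⟩ := hv₂.of_lease_pos i (State.mem_leased.1 hi).2
        obtain rfl : p = p' := Option.some.inj (hip.symm.trans hp')
        exact ⟨i, by simpa [State.admit, hif] using hip, hlev⟩
    · by_cases hif : i = f
      · subst hif
        obtain rfl : q = p := by simpa [State.admit] using hi
        exact hqp₂
      · exact hv₂.mem_pages i p (by simpa [State.admit, hif] using hi)
  have hf₃ : (st₂.admit q f).cache f = some q := by simp [State.admit]
  have hq₃ : ∀ i, (st₂.admit q f).cache i = some q → i = f := by
    intro i hi
    by_contra hif
    exact hq₂ i (by simpa [State.admit, hif] using hi)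
  obtain ⟨st₄, h₄, hins⟩ := hv₃.exists_relaxes_insertable ⟨q, .general⟩ hqp₂ hf₃
    (fun i hi => by rw [hq₃ i hi]; exact hfl.le)
  have hv₄ := h₄.valid hv₃
  have hw₄ : st₄.weight = st.weight := h₄.weight_eq.trans h₂.weight_eq
  have hp₄ : st₄.pages = st.pages := h₄.pages_eq.trans h₂.pages_eq
  have hcost₄ : (stepCost st.weight st.cache st₄.cache : ℝ) ≤ st.weight q := by
    rw [h₄.cache_eq]
    simp only [State.admit]
    rw [h₂.cache_eq]
    exact_mod_cast stepCost_update_le st.weight st.cache f q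
  have hpot₄ : ∀ C, Satisfies C ⟨q, .general⟩ →
      st₄.potential C + 5 * st.weight q ≤ st.potential C := by
    intro C hC
    have h1 := h₂.potential_le C hC
    have h2 := hpot₃ C hC
    have h3 := h₄.potential_le C hC
    rw [h₂.weight_eq] at h2
    linarith
  have hwq : (0 : ℝ) ≤ st.weight q := (st.weight q).2
  by_cases hpos : 0 < st₄.credit q
  swap
  -- Once its credit is used up, `q` may stay in the low slot `f`.
  · refine ⟨st₄, ⟨{ hv₄ with of_credit_pos := fun p _ hp => ?_ }, hw₄, hp₄,
      ⟨f, mem_univ _, by rw [h₄.cache_eq, hf₃]⟩, fun C hC => ?_⟩⟩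
    · refine hv₄.of_credit_pos p ?_ hp
      rintro rfl
      exact hpos hp
    · linarith [hpot₄ C hC]
  obtain ⟨D, hD1, hD2, hD3, hD4⟩ := exists_insert st₄.weight st₄.height (st₄.leased ∅) _
    (st₄.active ∅ q) q st₄.cache le_rfl (fun h => (State.mem_active.1 h).2.1 rfl)
    (hv₄.hosts ∅) (hins hpos)
  have hqp₄ : q ∈ st₄.pages := by rw [hp₄]; exact hqp
  refine ⟨{ st₄ with cache := D }, ⟨⟨hv₄.height_nonneg, hv₄.credit_nonneg, hv₄.lease_nonneg,
    hv₄.credit_le, fun i hi => ?_, fun p _ hp => ?_, hv₄.weight_eq_zero, fun i p hi => ?_⟩,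
    hw₄, hp₄, ?_, fun C hC => ?_⟩⟩
  · obtain ⟨p, hp⟩ := hv₄.of_lease_pos i hi
    exact ⟨p, (hD2 i (State.mem_leased.2 ⟨by simp, hi⟩)).trans hp.1, hp.2⟩
  · by_cases hact : p ∈ insert q (st₄.active ∅ q)
    · obtain ⟨i, -, hi⟩ := hD1 p hact
      exact ⟨i, hi⟩
    · have : ∃ i ∈ st₄.leased ∅, st₄.cache i = some p := by
        by_contra! hcon
        refine hact (mem_insert.2 (or_iff_not_imp_left.2 fun hpq => State.mem_active.2
          ⟨hv₄.mem_pages_of_credit_pos hp, hpq, hp, hcon⟩))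
      obtain ⟨i, hi, hip⟩ := this
      obtain ⟨p', hp', -, hlev⟩ := hv₄.of_lease_pos i (State.mem_leased.1 hi).2
      obtain rfl : p = p' := Option.some.inj (hip.symm.trans hp')
      exact ⟨i, (hD2 i hi).trans hip, hlev⟩
  · rcases hD3 i p hi with rfl | ⟨i', hi'⟩
    · exact hqp₄
    · exact hv₄.mem_pages i' p hi'
  · obtain ⟨i, -, hi, -⟩ := hD1 q (mem_insert_self _ _)
    exact ⟨i, mem_univ _, hi⟩
  · have h1 : State.potential { st₄ with cache := D } C = st₄.potential C :=
      State.potential_congr_cache (fun i hi => hD2 i (State.mem_leased.2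
        ⟨by simp, lt_of_le_of_ne (hv₄.lease_nonneg i) hi.symm⟩)) C
    have h2 : (stepCost st.weight st.cache D : ℝ) ≤
        stepCost st.weight st.cache st₄.cache + stepCost st.weight st₄.cache D := by
      exact_mod_cast stepCost_triangle _ _ _ _
    rw [hw₄] at hD4
    rw [h1]
    linarith [hpot₄ C hC, lowerPow_le (st.weight q)]

open Classical in
/-- The state in which `p` has been put into slot `j` with a full lease. -/
noncomputable def State.install (st : State k Page) (p : Page) (j : Fin k) (D : Config k Page) :
    State k Page :=
  { st with
    cache := Function.update D j (some p)
    height := Function.update st.height j (st.level p)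
    lease := Function.update st.lease j (st.weight p) }

open Classical in
-- The lease adds at most `(5k-1) w(p)`, the new height at most `4 w(p) - 4 height(j)`, and the
-- discount term subtracts at least `(5k+4) w(p)`. The old lease of `j` gave the adversary no
-- discount, because `j` did not cache `p`.
lemma State.Valid.potential_install_le {st : State k Page} {E : Set Page} (hst : st.Valid E)
    (hk : 1 ≤ k) {p : Page} {j : Fin k} {D : Config k Page} (hj : st.cache j ≠ some p)
    (hD : ∀ i ≠ j, st.lease i ≠ 0 → D i = st.cache i) {C : Config k Page} (hC : C j = some p) :
    (st.install p j D).potential C + st.weight p + 4 * st.height j ≤ st.potential C := by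
  have hl : ∑ i, Function.update st.lease j (st.weight p : ℝ) i ≤
      ∑ i, st.lease i + st.weight p := by
    rw [sum_update_of_mem (mem_univ j), ← add_sum_erase univ st.lease (mem_univ j),
      sdiff_singleton_eq_erase]
    linarith [hst.lease_nonneg j]
  have hh : ∑ i, Function.update st.height j (st.level p) i + st.height j ≤
      ∑ i, st.height i + st.weight p := by
    rw [sum_update_of_mem (mem_univ j), ← add_sum_erase univ st.height (mem_univ j),
      sdiff_singleton_eq_erase]
    linarith [st.level_le p]
  have hd : ∑ i, st.discount i (C i) + st.weight p ≤ ∑ i, (st.install p j D).discount i (C i) := by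
    have h3 : (st.weight p : ℝ) = ∑ i : Fin k, if i = j then (st.weight p : ℝ) else 0 := by simp
    conv_lhs => rw [h3, ← sum_add_distrib]
    refine sum_le_sum fun i _ => ?_
    by_cases hi : i = j
    · subst hi
      have hd' : (st.install p i D).discount i (some p) = st.credit p +
          min (st.level p) (st.level p) + st.weight p := by
        rw [State.discount_some]
        simp [State.install, State.level]
      rw [hC, hd', State.discount_some, if_neg hj, if_pos rfl, min_self]
      linarith [min_le_left (st.level p) (st.height i)]
    · rw [if_neg hi, add_zero]
      cases C i with
      | none => exact le_rfl
      | some x =>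
        rw [State.discount_some, State.discount_some]
        simp only [State.install, State.level, Function.update_of_ne hi]
        by_cases hli : st.lease i = 0
        · simp [hli]
        · rw [hD i hi hli]
  have h4 := mul_le_mul_of_nonneg_left hd (by positivity : (0 : ℝ) ≤ 5 * k + 4)
  have hk' : (1 : ℝ) ≤ k := by exact_mod_cast hk
  have h5 := mul_le_mul_of_nonneg_left hl (by linarith : (0 : ℝ) ≤ 5 * k - 1)
  unfold State.potential
  have e1 : (st.install p j D).lease = Function.update st.lease j (st.weight p) := rfl
  have e2 : (st.install p j D).height = Function.update st.height j (st.level p) := rfl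
  have e3 : ∑ x ∈ (st.install p j D).pages, (st.install p j D).credit x =
      ∑ x ∈ st.pages, st.credit x := rfl
  rw [e1, e2, e3]
  linarith

open Classical in
theorem State.Valid.exists_serves_specific {st : State k Page} (hst : st.Valid ∅) (hk : 1 ≤ k)
    {p : Page} {j : Fin k} (hpp : p ∈ st.pages) (hj : st.cache j ≠ some p) :
    ∃ st', st.Serves ⟨p, .specific j⟩ st' := by
  obtain ⟨st₂, h₂, hvac⟩ := st.exists_relaxes_vacatable p j
  have hv₂ := h₂.valid hst
  have hj₂ : st₂.cache j ≠ some p := by rw [h₂.cache_eq]; exact hj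
  have hpp₂ : p ∈ st₂.pages := by rw [h₂.pages_eq]; exact hpp
  have hH := (hv₂.mono (Set.empty_subset {p})).hosts {j}
  obtain ⟨D, hD1, hD2, hD3, hD4⟩ : ∃ D : Config k Page,
      Hosts st₂.weight st₂.height (insert j (st₂.leased {j})) D (st₂.active {j} p) ∧
      (∀ i ∈ st₂.leased {j}, D i = st₂.cache i) ∧
      (∀ i x, D i = some x → x ∈ st₂.pages) ∧
      (stepCost st₂.weight st₂.cache D : ℝ) ≤ 4 * st₂.height j := by
    have : Nonempty (Fin k) := ⟨j⟩
    choose! ρ hρF hρ hρh using hH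
    -- Only an active page hosted by `j` must be moved; its level is at most the height of `j`,
    -- which bounds the cost of the chain.
    by_cases hx : ∃ x ∈ st₂.active {j} p, ρ x = j
    · obtain ⟨x, hx, hxj⟩ := hx
      have hne : ∀ y ∈ (st₂.active {j} p).erase x, ρ y ≠ j := by
        intro y hy hyj
        have h1 := hρ x hx
        rw [hxj, ← hyj, hρ y (mem_of_mem_erase hy)] at h1
        exact ne_of_mem_erase hy (Option.some.inj h1)
      obtain ⟨D, hD1, hD2, hD3, hD4⟩ := exists_insert st₂.weight st₂.height
        (insert j (st₂.leased {j})) _ ((st₂.active {j} p).erase x) x st₂.cache le_rfl (by simp)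
        (fun y hy => ⟨ρ y, by
          rw [mem_insert, not_or]
          exact ⟨hne y hy, hρF y (mem_of_mem_erase hy)⟩, hρ y (mem_of_mem_erase hy),
          hρh y (mem_of_mem_erase hy)⟩)
        (fun ω hω => by
          refine le_trans (le_of_eq ?_) (hvac ω)
          rw [filter_erase]
          exact card_erase_add_one (mem_filter.2 ⟨hx, hω⟩))
      rw [insert_erase hx] at hD1
      refine ⟨D, hD1, fun i hi => hD2 i (mem_insert_of_mem hi), fun i y hi => ?_, ?_⟩
      · rcases hD3 i y hi with rfl | ⟨i', hi'⟩
        · exact (State.mem_active.1 hx).1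
        · exact hv₂.mem_pages i' y hi'
      · have := hρh x hx
        rw [hxj] at this
        linarith
    · refine ⟨st₂.cache, fun x hx' => ⟨ρ x, ?_, hρ x hx', hρh x hx'⟩, fun _ _ => rfl,
        hv₂.mem_pages, ?_⟩
      · rw [mem_insert, not_or]
        exact ⟨fun h => hx ⟨x, hx', h⟩, hρF x hx'⟩
      · rw [stepCost_self]
        simpa using hv₂.height_nonneg j
  have hlevel : ∀ x, (st₂.install p j D).level x = st₂.level x := fun _ => rfl
  have hcache : (st₂.install p j D).cache = Function.update D j (some p) := rfl
  have hheight : (st₂.install p j D).height = Function.update st₂.height j (st₂.level p) := rfl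
  have hlease : (st₂.install p j D).lease = Function.update st₂.lease j (st₂.weight p : ℝ) := rfl
  have hweight : (st₂.install p j D).weight = st₂.weight := rfl
  refine ⟨st₂.install p j D, ⟨⟨fun i => ?_, hv₂.credit_nonneg, fun i => ?_, hv₂.credit_le,
    fun i hi => ?_, fun x _ hx => ?_, hv₂.weight_eq_zero, fun i x hi => ?_⟩,
    h₂.weight_eq, h₂.pages_eq, ⟨j, mem_singleton_self j, by simp [hcache]⟩, fun C hC => ?_⟩⟩
  · by_cases hij : i = j
    · subst hij; simpa [hheight] using st₂.level_nonneg p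
    · simpa [hcache, hheight, hlease, hweight, hij] using hv₂.height_nonneg i
  · by_cases hij : i = j
    · subst hij; simp [hlease]
    · simpa [hcache, hheight, hlease, hweight, hij] using hv₂.lease_nonneg i
  · by_cases hij : i = j
    · subst hij
      exact ⟨p, by simp [hcache], by simp [hlease, hweight], by simp [hheight, hlevel]⟩
    · have hi' : 0 < st₂.lease i := by simpa [hcache, hheight, hlease, hweight, hij] using hi
      obtain ⟨x, hx, hx2, hx3⟩ := hv₂.of_lease_pos i hi'
      rw [← hD2 i (State.mem_leased.2 ⟨by simpa using hij, hi'⟩)] at hx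
      exact ⟨x, by simpa [hcache, hheight, hlease, hweight, hij] using hx, by simpa [hcache, hheight, hlease, hweight, hij] using hx2,
        by simpa [hcache, hheight, hlease, hweight, hij, hlevel] using hx3⟩
  · have hx' : 0 < st₂.credit x := hx
    by_cases hxp : x = p
    · subst hxp
      exact ⟨j, by simp [hcache], by simp [hheight, hlevel]⟩
    have : ∃ i, i ≠ j ∧ D i = some x ∧ st₂.level x ≤ st₂.height i := by
      by_cases hact : x ∈ st₂.active {j} p
      · obtain ⟨i, hi, hi'⟩ := hD1 x hact
        exact ⟨i, fun h => hi (mem_insert.2 (Or.inl h)), hi'⟩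
      · have : ∃ i ∈ st₂.leased {j}, st₂.cache i = some x := by
          by_contra! hcon
          exact hact (State.mem_active.2 ⟨hv₂.mem_pages_of_credit_pos hx', hxp, hx', hcon⟩)
        obtain ⟨i, hi, hix⟩ := this
        obtain ⟨x', hx', -, hlev⟩ := hv₂.of_lease_pos i (State.mem_leased.1 hi).2
        obtain rfl : x = x' := Option.some.inj (hix.symm.trans hx')
        exact ⟨i, by simpa using (State.mem_leased.1 hi).1, (hD2 i hi).trans hix, hlev⟩
    obtain ⟨i, hij, hi1, hi2⟩ := this
    exact ⟨i, by simpa [hcache, hheight, hlease, hweight, hij] using hi1,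
      by simpa [hcache, hheight, hlease, hweight, hij, hlevel] using hi2⟩
  · by_cases hij : i = j
    · subst hij
      obtain rfl : p = x := by simpa [hcache, hheight, hlease, hweight] using hi
      exact hpp₂
    · exact hD3 i x (by simpa [hcache, hheight, hlease, hweight, hij] using hi)
  · have hCj : C j = some p := by
      obtain ⟨s, hs, hs'⟩ := hC
      obtain rfl : s = j := by simpa [SlotSpec.slots] using hs
      exact hs'
    have h1 := h₂.potential_le C hC
    have h2 := hv₂.potential_install_le hk hj₂ (D := D) (fun i hij hi => hD2 i (State.mem_leased.2
      ⟨by simpa using hij, lt_of_le_of_ne (hv₂.lease_nonneg i) hi.symm⟩)) hCj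
    have h3 : (stepCost st.weight st.cache (st₂.install p j D).cache : ℝ) ≤
        stepCost st.weight st.cache D + stepCost st.weight D (Function.update D j (some p)) := by
      exact_mod_cast stepCost_triangle _ _ _ _
    have h4 : (stepCost st.weight D (Function.update D j (some p)) : ℝ) ≤ st.weight p := by
      exact_mod_cast stepCost_update_le st.weight D j p
    rw [h₂.weight_eq, h₂.cache_eq] at hD4
    rw [h₂.weight_eq] at h2
    linarith

theorem State.Valid.exists_serves {st : State k Page} (hst : st.Valid ∅) (hk : 1 ≤ k)
    (r : Request k Page) (hp : r.page ∈ st.pages) : ∃ st', st.Serves r st' := by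
  by_cases hs : Satisfies st.cache r
  · exact ⟨st, hst, rfl, rfl, hs, fun C _ => by simp [stepCost_self]⟩
  obtain ⟨p, spec⟩ := r
  cases spec with
  | general =>
    exact hst.exists_serves_general hk hp fun i hi => hs ⟨i, mem_univ i, hi⟩
  | specific j =>
    exact hst.exists_serves_specific hk hp fun hj => hs ⟨j, mem_singleton_self j, hj⟩

end Step

/-! ### The online algorithm and its amortised analysis. -/

section Online

variable {k : ℕ} {Page : Type*}

/-- The state before the first request. -/
noncomputable def State.initial (k : ℕ) (Page : Type*) : State k Page where
  cache := emptyConfig k Page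
  height _ := 0
  credit _ := 0
  lease _ := 0
  weight _ := 0
  pages := ∅

lemma State.valid_initial : (State.initial k Page).Valid ∅ := by
  constructor <;> simp [State.initial, emptyConfig]

lemma State.potential_initial :
    (State.initial k Page).potential (emptyConfig k Page) = 0 := by
  simp [State.potential, State.initial, State.discount, emptyConfig]

open Classical in
/-- Record the weight of a requested page. -/
noncomputable def State.record (st : State k Page) (p : Page) (ω : ℝ≥0) : State k Page :=
  { st with
    weight := Function.update st.weight p ω
    pages := insert p st.pages }

lemma State.Valid.credit_eq_zero {st : State k Page} {E : Set Page} (hst : st.Valid E) {p : Page}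
    (hp : p ∉ st.pages) : st.credit p = 0 :=
  le_antisymm (by simpa [hst.weight_eq_zero p hp] using hst.credit_le p) (hst.credit_nonneg p)

lemma State.record_weight_of_mem {st : State k Page} {p x : Page} {ω : ℝ≥0}
    (hω : p ∈ st.pages → st.weight p = ω) (hx : x ∈ st.pages) :
    (st.record p ω).weight x = st.weight x := by
  by_cases hxp : x = p
  · subst hxp; simp [State.record, hω hx]
  · simp [State.record, hxp]

lemma State.Valid.record {st : State k Page} (hst : st.Valid ∅) {p : Page} {ω : ℝ≥0}
    (hω : p ∈ st.pages → st.weight p = ω) : (st.record p ω).Valid ∅ where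
  height_nonneg := hst.height_nonneg
  credit_nonneg := hst.credit_nonneg
  lease_nonneg := hst.lease_nonneg
  credit_le x := by
    by_cases hx : x ∈ st.pages
    · rw [State.record_weight_of_mem hω hx]; exact hst.credit_le x
    · exact (hst.credit_eq_zero hx).le.trans (NNReal.coe_nonneg _)
  of_lease_pos i hi := by
    obtain ⟨x, h1, h2⟩ := hst.of_lease_pos i hi
    refine ⟨x, h1, ?_⟩
    rw [State.level, State.record_weight_of_mem hω (hst.mem_pages i x h1)]
    exact h2
  of_credit_pos x hx hx' := by
    obtain ⟨i, h1, h2⟩ := hst.of_credit_pos x hx hx'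
    refine ⟨i, h1, ?_⟩
    rw [State.level, State.record_weight_of_mem hω (hst.mem_pages i x h1)]
    exact h2
  weight_eq_zero x hx := by
    have hx' : x ≠ p ∧ x ∉ st.pages := by simpa [State.record] using hx
    simpa [State.record, hx'.1] using hst.weight_eq_zero x hx'.2
  mem_pages i x hx := by
    classical exact mem_insert_of_mem (hst.mem_pages i x hx)

/-- An unrecorded page has weight, level and credit zero, so learning its weight can only increase
discounts. -/
lemma State.Valid.potential_record_le {st : State k Page} (hst : st.Valid ∅) {p : Page} {ω : ℝ≥0}
    (hω : p ∈ st.pages → st.weight p = ω) (C : Config k Page) :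
    (st.record p ω).potential C ≤ st.potential C := by
  classical
  have h1 : ∑ x ∈ (st.record p ω).pages, (st.record p ω).credit x = ∑ x ∈ st.pages, st.credit x := by
    have : (st.record p ω).pages = insert p st.pages := by simp [State.record]
    rw [this]
    by_cases hp : p ∈ st.pages
    · rw [insert_eq_of_mem hp]; rfl
    · rw [sum_insert hp]
      simp [State.record, hst.credit_eq_zero hp]
  have h2 : ∑ i, st.discount i (C i) ≤ ∑ i, (st.record p ω).discount i (C i) := by
    refine sum_le_sum fun i _ => ?_
    cases C i with
    | none => exact le_rfl
    | some x =>
      have hl : st.level x ≤ (st.record p ω).level x := by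
        by_cases hx : x ∈ st.pages
        · rw [State.level, State.level, State.record_weight_of_mem hω hx]
        · rw [State.level, hst.weight_eq_zero x hx, lowerPow_zero]
          exact State.level_nonneg _ _
      have h3 := min_le_min hl (le_refl (st.height i))
      rw [State.discount_some, State.discount_some]
      exact add_le_add (add_le_add le_rfl h3) le_rfl
  have h3 := mul_le_mul_of_nonneg_left h2 (by positivity : (0 : ℝ) ≤ 5 * k + 4)
  unfold State.potential
  rw [h1]
  have e1 : (st.record p ω).lease = st.lease := rfl
  have e2 : (st.record p ω).height = st.height := rfl
  rw [e1, e2]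
  linarith

lemma State.Valid.discount_nonneg {st : State k Page} (hst : st.Valid ∅) (i : Fin k)
    (o : Option Page) : 0 ≤ st.discount i o := by
  cases o with
  | none => exact le_rfl
  | some p =>
    rw [State.discount_some]
    have h1 := hst.credit_nonneg p
    have h2 := le_min (st.level_nonneg p) (hst.height_nonneg i)
    have h3 := hst.lease_nonneg i
    split_ifs <;> linarith

open Classical in
-- Credit, level and lease are each at most the weight, hence the factor 3.
lemma State.Valid.discount_le {st : State k Page} (hst : st.Valid ∅) (i : Fin k) (p : Page) :
    st.discount i (some p) ≤ 3 * st.weight p := by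
  rw [State.discount_some]
  have h1 := hst.credit_le p
  have h2 := (min_le_left (st.level p) (st.height i)).trans (st.level_le p)
  have h3 : (if st.cache i = some p then st.lease i else 0) ≤ (st.weight p : ℝ) := by
    split_ifs with hc
    · by_cases hl : 0 < st.lease i
      · obtain ⟨x, hx, hx', -⟩ := hst.of_lease_pos i hl
        obtain rfl : p = x := Option.some.inj (hc.symm.trans hx)
        exact hx'
      · exact (not_lt.1 hl).trans (NNReal.coe_nonneg _)
    · exact NNReal.coe_nonneg _
  linarith

/-- The weight of a slot's content. -/
noncomputable def contentWeight (w : Page → ℝ≥0) : Option Page → ℝ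
  | none => 0
  | some p => w p

/-- The full potential, in terms of the true weights. -/
noncomputable def State.fullPotential (st : State k Page) (w : Page → ℝ≥0) (C : Config k Page) :
    ℝ :=
  st.potential C + 3 * (5 * k + 4) * ∑ i, contentWeight w (C i)

lemma State.Valid.discount_le_contentWeight {st : State k Page} (hst : st.Valid ∅)
    {w : Page → ℝ≥0} (hw : ∀ p, st.weight p ≤ w p) (i : Fin k) (o : Option Page) :
    st.discount i o ≤ 3 * contentWeight w o := by
  cases o with
  | none => simp [State.discount, contentWeight]
  | some p =>
    have : (st.weight p : ℝ) ≤ w p := hw p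
    exact (hst.discount_le i p).trans (by simp only [contentWeight]; linarith)

lemma State.Valid.fullPotential_nonneg {st : State k Page} (hst : st.Valid ∅) (hk : 1 ≤ k)
    {w : Page → ℝ≥0} (hw : ∀ p, st.weight p ≤ w p) (C : Config k Page) :
    0 ≤ st.fullPotential w C := by
  have h1 : ∑ i, st.discount i (C i) ≤ 3 * ∑ i, contentWeight w (C i) := by
    rw [mul_sum]
    exact sum_le_sum fun i _ => hst.discount_le_contentWeight hw i _
  have h2 := mul_le_mul_of_nonneg_left h1 (by positivity : (0 : ℝ) ≤ 5 * k + 4)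
  have hk' : (1 : ℝ) ≤ k := by exact_mod_cast hk
  have h3 : 0 ≤ (5 * (k : ℝ) - 1) * (∑ p ∈ st.pages, st.credit p + ∑ i, st.lease i) :=
    mul_nonneg (by linarith) (add_nonneg (sum_nonneg fun p _ => hst.credit_nonneg p)
      (sum_nonneg fun i _ => hst.lease_nonneg i))
  have h4 : 0 ≤ ∑ i, st.height i := sum_nonneg fun i _ => hst.height_nonneg i
  unfold State.fullPotential State.potential
  linarith

/-- In each slot, three times the content weight minus the discount lies between zero and three
times the content weight. Where the content changes, the weight of the new content is the retrieval
cost. -/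
lemma State.Valid.fullPotential_le {st : State k Page} (hst : st.Valid ∅)
    {w : Page → ℝ≥0} (hw : ∀ p, st.weight p ≤ w p) (C D : Config k Page) :
    st.fullPotential w D ≤ st.fullPotential w C + 3 * (5 * k + 4) * stepCost w C D := by
  have h1 : ∑ i, (3 * contentWeight w (D i) - st.discount i (D i)) ≤
      ∑ i, (3 * contentWeight w (C i) - st.discount i (C i) + 3 * (slotCost w (C i) (D i) : ℝ)) := by
    refine sum_le_sum fun i _ => ?_
    have h2 := hst.discount_le_contentWeight hw i (C i)
    have h3 := hst.discount_nonneg i (D i)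
    have h4 : (0 : ℝ) ≤ slotCost w (C i) (D i) := NNReal.coe_nonneg _
    by_cases hCD : C i = D i
    · rw [hCD] at h4 ⊢
      linarith
    · have h5 : contentWeight w (D i) = slotCost w (C i) (D i) := by
        cases hD : D i with
        | none => simp [contentWeight, slotCost]
        | some p =>
          rw [hD] at hCD
          simp [contentWeight, slotCost, hCD]
      rw [← h5]
      linarith
  rw [sum_add_distrib, sum_sub_distrib, sum_sub_distrib, ← mul_sum, ← mul_sum, ← mul_sum] at h1
  have h6 := mul_le_mul_of_nonneg_left h1 (by positivity : (0 : ℝ) ≤ 5 * k + 4)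
  unfold State.fullPotential State.potential stepCost
  rw [NNReal.coe_sum]
  linarith

open Classical in
/-- The state after the next request, which comes with the weight of its page. -/
noncomputable def State.next (st : State k Page) (x : Request k Page × ℝ≥0) : State k Page :=
  if h : ∃ st', (st.record x.1.page x.2).Serves x.1 st' then h.choose else st

lemma State.Valid.serves_next {st : State k Page} (hst : st.Valid ∅) (hk : 1 ≤ k)
    {x : Request k Page × ℝ≥0} (hx : x.1.page ∈ st.pages → st.weight x.1.page = x.2) :
    (st.record x.1.page x.2).Serves x.1 (st.next x) := by
  have h : ∃ st', (st.record x.1.page x.2).Serves x.1 st' :=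
    (hst.record hx).exists_serves hk x.1 (by classical exact mem_insert_self _ _)
  rw [State.next, dif_pos h]
  exact h.choose_spec

/-- The state of the algorithm after the given requests. -/
noncomputable def State.after (l : List (Request k Page × ℝ≥0)) : State k Page :=
  l.foldl State.next (State.initial k Page)

/-- The online algorithm. -/
noncomputable def algorithm (k : ℕ) (Page : Type*) : OnlineAlgorithm k Page :=
  fun l => (State.after l).cache

/-- The state after `t` requests of `σ`. -/
noncomputable def State.atTime (w : Page → ℝ≥0) (σ : List (Request k Page)) (t : ℕ) : State k Page :=
  State.after ((σ.take t).map fun r => (r, w r.page))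

lemma run_algorithm (w : Page → ℝ≥0) (σ : List (Request k Page)) (t : ℕ) :
    (algorithm k Page).run w σ t = (State.atTime w σ t).cache := by
  cases t <;> rfl

lemma State.atTime_succ (w : Page → ℝ≥0) (σ : List (Request k Page)) {t : ℕ} (ht : t < σ.length) :
    State.atTime w σ (t + 1) = (State.atTime w σ t).next (σ[t], w σ[t].page) := by
  unfold State.atTime State.after
  have h : σ.take (t + 1) = σ.take t ++ [σ[t]] := by
    rw [List.take_add_one, List.getElem?_eq_getElem ht]; rfl
  rw [h, List.map_append, List.foldl_append]
  rfl

lemma State.valid_at (hk : 1 ≤ k) (w : Page → ℝ≥0) (σ : List (Request k Page)) (t : ℕ)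
    (ht : t ≤ σ.length) : (State.atTime w σ t).Valid ∅ ∧
      ∀ p ∈ (State.atTime w σ t).pages, (State.atTime w σ t).weight p = w p := by
  classical
  induction t with
  | zero => exact ⟨State.valid_initial, by simp [State.atTime, State.after, State.initial]⟩
  | succ t ih =>
    obtain ⟨h1, h2⟩ := ih (by omega)
    have ht' : t < σ.length := by omega
    have hs := h1.serves_next hk (x := (σ[t], w σ[t].page)) (h2 _)
    rw [← State.atTime_succ w σ ht'] at hs
    refine ⟨hs.valid, fun p hp => ?_⟩
    rw [hs.weight_eq]
    rw [hs.pages_eq] at hp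
    rcases mem_insert.1 hp with rfl | hp
    · simp [State.record]
    · rw [State.record_weight_of_mem (h2 _) hp, h2 p hp]

lemma State.weight_at_le (hk : 1 ≤ k) (w : Page → ℝ≥0) (σ : List (Request k Page)) (t : ℕ)
    (ht : t ≤ σ.length) (p : Page) : (State.atTime w σ t).weight p ≤ w p := by
  obtain ⟨h1, h2⟩ := State.valid_at hk w σ t ht
  by_cases hp : p ∈ (State.atTime w σ t).pages
  · exact (h2 p hp).le
  · rw [h1.weight_eq_zero p hp]; exact zero_le

lemma State.serves_at (hk : 1 ≤ k) (w : Page → ℝ≥0) (σ : List (Request k Page)) {t : ℕ}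
    (ht : t < σ.length) : ((State.atTime w σ t).record σ[t].page (w σ[t].page)).Serves σ[t]
      (State.atTime w σ (t + 1)) := by
  obtain ⟨h1, h2⟩ := State.valid_at hk w σ t ht.le
  rw [State.atTime_succ w σ ht]
  exact h1.serves_next hk (x := (σ[t], w σ[t].page)) (h2 _)

theorem isSolution_run_algorithm (hk : 1 ≤ k) (w : Page → ℝ≥0) (σ : List (Request k Page)) :
    IsSolution σ ((algorithm k Page).run w σ) := by
  refine ⟨rfl, fun t ht => ?_⟩
  rw [run_algorithm]
  exact (State.serves_at hk w σ ht).satisfies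

/-- Each step splits into the adversary's move, the recording of the weight, and the algorithm's
response to an adversary that already satisfies the request. -/
theorem cost_run_algorithm_le (hk : 1 ≤ k) (w : Page → ℝ≥0) (σ : List (Request k Page))
    {C : ℕ → Config k Page} (hC : IsSolution σ C) (t : ℕ) (ht : t ≤ σ.length) :
    (cost w t ((algorithm k Page).run w σ) : ℝ) + (State.atTime w σ t).fullPotential w (C t) ≤
      3 * (5 * k + 4) * cost w t C := by
  induction t with
  | zero =>
    have h0 : State.atTime w σ 0 = State.initial k Page := by simp [State.atTime, State.after]
    rw [h0, hC.1, State.fullPotential, State.potential_initial]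
    simp [cost, emptyConfig, contentWeight]
  | succ t ih =>
    have ht' : t < σ.length := by omega
    have hih := ih ht'.le
    obtain ⟨h1, h2⟩ := State.valid_at hk w σ t ht'.le
    have hmove := h1.fullPotential_le (State.weight_at_le hk w σ t ht'.le) (C t) (C (t + 1))
    have hs := State.serves_at hk w σ ht'
    have hpot := hs.potential_le _ (hC.2 t ht')
    have hrec := h1.potential_record_le (h2 σ[t].page) (C (t + 1))
    -- Every page in the new cache has been recorded with its true weight, so both weight functions
    -- charge the same cost.
    have hcost : stepCost w (State.atTime w σ t).cache (State.atTime w σ (t + 1)).cache =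
        stepCost ((State.atTime w σ t).record σ[t].page (w σ[t].page)).weight
          (State.atTime w σ t).cache (State.atTime w σ (t + 1)).cache := by
      refine stepCost_congr fun i p hp => ?_
      obtain ⟨h3, h4⟩ := State.valid_at hk w σ (t + 1) ht
      rw [← h4 p (h3.mem_pages i p hp), hs.weight_eq]
    have e : ((State.atTime w σ t).record σ[t].page (w σ[t].page)).cache = (State.atTime w σ t).cache := rfl
    rw [e, ← hcost] at hpot
    unfold cost at hih ⊢
    rw [sum_range_succ, sum_range_succ, run_algorithm, run_algorithm, NNReal.coe_add,
      NNReal.coe_add]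
    unfold State.fullPotential at hih hmove ⊢
    linarith

theorem isCompetitive_algorithm (hk : 1 ≤ k) :
    (algorithm k Page).IsCompetitive (24 * (k : ℝ≥0) + 3) 0 := by
  intro w σ
  refine ⟨isSolution_run_algorithm hk w σ, ?_⟩
  rw [add_zero]
  have hpos : (0 : ℝ≥0) < 24 * (k : ℝ≥0) + 3 := by positivity
  have key : ∀ C : ℕ → Config k Page, IsSolution σ C →
      cost w σ.length ((algorithm k Page).run w σ) ≤
        (24 * (k : ℝ≥0) + 3) * cost w σ.length C := by
    intro C hC
    have h1 := cost_run_algorithm_le hk w σ hC σ.length le_rfl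
    have h2 := (State.valid_at hk w σ σ.length le_rfl).1.fullPotential_nonneg hk
      (State.weight_at_le hk w σ σ.length le_rfl) (C σ.length)
    have hk' : (1 : ℝ) ≤ k := by exact_mod_cast hk
    -- `15k + 12 ≤ 24k + 3` is `9 ≤ 9k`.
    have h3 : (3 * (5 * (k : ℝ) + 4)) * cost w σ.length C ≤
        (24 * k + 3) * cost w σ.length C :=
      mul_le_mul_of_nonneg_right (by linarith) (NNReal.coe_nonneg _)
    rw [← NNReal.coe_le_coe]
    push_cast
    linarith
  rw [← div_le_iff₀' hpos]
  refine le_csInf ?_ ?_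
  · obtain ⟨C, hC⟩ := exists_isSolution hk σ
    exact ⟨_, C, hC, rfl⟩
  · rintro _ ⟨C, hC, rfl⟩
    rw [div_le_iff₀' hpos]
    exact key C hC

end Online

end WeightedAllOrOnePaging

theorem mainTheorem6 (k : ℕ) (hk : 1 ≤ k) (Page : Type*) :
    ∃ A : WeightedAllOrOnePaging.OnlineAlgorithm k Page,
      WeightedAllOrOnePaging.OnlineAlgorithm.IsCompetitive A (24 * (k : ℝ≥0) + 3) 0 :=
  ⟨WeightedAllOrOnePaging.algorithm k Page, WeightedAllOrOnePaging.isCompetitive_algorithm hk⟩
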